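/- Let $C$ be a smooth irreducible complex affine algebraic curve, with algebra of regular functions $\mathcal O(C)$ and module of regular differentials $\Omega(C)$, and let $p:\tilde C\to C$ be a universal cover of the analytic curve underlying $C$. Let $\mathcal O_{hol}(\tilde C)$ be the algebra of holomorphic functions on $\tilde C$, $\Omega_{hol}(\tilde C)$ its space of holomorphic $1$-forms, and $\Omega^\bullet_{hol}(\tilde C)=(\mathcal O_{hol}(\tilde C)\oplus\Omega_{hol}(\tilde C),d)$ the differential graded algebra (dga) of holomorphic forms, concentrated in degrees $0$ and $1$. Via $p^*$, regard $\Omega^\bullet(C)=(\mathcal O(C)\oplus\Omega(C),d)$ as a sub-dga of $\Omega^\bullet_{hol}(\tilde C)$. A *stable subalgebra* is a unital subalgebra $A\subset\mathcal O_{hol}(\tilde C)$ such that for all $f\in A$, $\omega\in\Omega(C)$ and $x_0\in\tilde C$, the function $z\mapsto\int_{x_0}^z f\cdot p^*\omega$ belongs to $A$; let $A_C$ be the intersection of all stable subalgebras. An *acyclic extension* of $\Omega^\bullet(C)$ is a graded sub-dga $E^\bullet$ with $\Omega^\bullet(C)\subset E^\bullet\subset\Omega^\bullet_{hol}(\tilde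 C)$ and $\mathrm H^1(E^\bullet)=0$; let $E_C^\bullet$ be the intersection of all acyclic extensions. Then $A_C$ is itself a stable subalgebra (hence the smallest one), $E_C^\bullet$ is itself an acyclic extension of $\Omega^\bullet(C)$ (hence the smallest one), and $$E_C^\bullet=(A_C\oplus d(A_C),d),$$ that is, $E_C^0=A_C$ and $E_C^1=d(A_C)$. -/

import Mathlib

open scoped Manifold ContDiff Topology

noncomputable section

/-! ## The analytic curve underlying an affine curve -/

/-- The set of complex points of the affine variety with coordinate ring `R`. -/
def ComplexPoints (R : Type*) [CommRing R] [Algebra ℂ R] : Type _ := R →ₐ[ℂ] ℂ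

namespace ComplexPoints

variable {R : Type*} [CommRing R] [Algebra ℂ R]

/-- The value of the regular function `r` at the complex point `x`. -/
def eval (x : ComplexPoints R) (r : R) : ℂ := (show R →ₐ[ℂ] ℂ from x) r

/-- The classical topology: the coarsest one for which all regular functions are continuous. For
`R` of finite type, it is the topology of `C(ℂ) ⊆ ℂⁿ` for any closed embedding of `C` in an affine
space. -/
instance : TopologicalSpace (ComplexPoints R) := TopologicalSpace.induced eval inferInstance

/-- A function on the analytic space is holomorphic at `x` if, near `x`, it is the restriction of
a holomorphic function of finitely many regular functions (that is, of a holomorphic function on an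
open subset of an ambient affine space). -/
def HolomorphicAt (g : ComplexPoints R → ℂ) (x : ComplexPoints R) : Prop :=
  ∃ (n : ℕ) (r : Fin n → R) (F : (Fin n → ℂ) → ℂ),
    AnalyticAt ℂ F (fun i => x.eval (r i)) ∧ ∀ᶠ y in 𝓝 x, g y = F (fun i => y.eval (r i))

theorem holomorphicAt_eval (r : R) (x : ComplexPoints R) :
    HolomorphicAt (fun y => y.eval r) x :=
  ⟨1, fun _ => r, fun v => v 0,
    (ContinuousLinearMap.proj (R := ℂ) (φ := fun _ : Fin 1 => ℂ) 0).analyticAt _,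
    Filter.Eventually.of_forall fun _ => rfl⟩

end ComplexPoints

/-- A universal cover `p : X → C` of the analytic curve underlying the affine curve with coordinate
ring `R`: `X` is a simply connected Riemann surface and `p` is a surjective covering map which is
locally biholomorphic, that is, which locally identifies the holomorphic functions on the analytic
curve with those on `X`. -/
structure UniversalCover (R : Type*) [CommRing R] [Algebra ℂ R] (X : Type*) [TopologicalSpace X]
    [ChartedSpace ℂ X] [IsManifold 𝓘(ℂ) ω X] [SimplyConnectedSpace X] where
  /-- the projection -/
  proj : X → ComplexPoints R
  isCoveringMap : IsCoveringMap proj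
  surjective : Function.Surjective proj
  holomorphicAt_iff : ∀ (x : X) (g : ComplexPoints R → ℂ),
    ComplexPoints.HolomorphicAt g (proj x) ↔ ContMDiffAt 𝓘(ℂ) 𝓘(ℂ) ω (g ∘ proj) x

/-! ## The dga of holomorphic differential forms on a Riemann surface -/

section Forms

variable (X : Type*) [TopologicalSpace X] [ChartedSpace ℂ X] [IsManifold 𝓘(ℂ) ω X]

/-- The algebra of holomorphic functions. -/
abbrev HolFun : Type _ := C^ω⟮𝓘(ℂ), X; ℂ⟯

/-- The holomorphic cotangent bundle. -/
abbrev Cotangent (x : X) : Type _ := TangentSpace 𝓘(ℂ) x →L[ℂ] Bundle.Trivial X ℂ x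

/-- The space of holomorphic 1-forms: holomorphic sections of the cotangent bundle. -/
abbrev HolForm : Type _ := Cₛ^ω⟮𝓘(ℂ); ℂ →L[ℂ] ℂ, Cotangent X⟯

variable {X}

instance : SMul (HolFun X) (HolForm X) :=
  ⟨fun f η => ⟨fun x => f x • η x,
    ContMDiff.smul_section (F := ℂ →L[ℂ] ℂ) (V := Cotangent X) f.contMDiff η.contMDiff⟩⟩

theorem HolForm.smul_apply (f : HolFun X) (η : HolForm X) (x : X) : (f • η) x = f x • η x := rfl

instance : Module (HolFun X) (HolForm X) where
  one_smul η := ContMDiffSection.ext fun x => one_smul ℂ (η x)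
  mul_smul f g η := ContMDiffSection.ext fun x => mul_smul (f x) (g x) (η x)
  smul_zero f := ContMDiffSection.ext fun x => smul_zero (A := Cotangent X x) (f x)
  smul_add f η θ := ContMDiffSection.ext fun x => smul_add (f x) (η x) (θ x)
  add_smul f g η := ContMDiffSection.ext fun x => add_smul (f x) (g x) (η x)
  zero_smul η := ContMDiffSection.ext fun x => zero_smul ℂ (η x)

instance : IsScalarTower ℂ (HolFun X) (HolForm X) :=
  ⟨fun c f η => ContMDiffSection.ext fun x => smul_assoc c (f x) (η x)⟩

/-- The differential `d` from holomorphic functions to holomorphic 1-forms. -/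
def HolFun.d : Derivation ℂ (HolFun X) (HolForm X) where
  toFun f := ⟨fun x => mfderiv 𝓘(ℂ) 𝓘(ℂ) f x, by
    intro x
    rw [contMDiffAt_hom_bundle]
    refine ⟨contMDiffAt_id, ?_⟩
    have h := (f.contMDiff x).mfderiv_const (m := ω) (by simp)
    convert h using 1
    ext y
    simp [inTangentCoordinates, ContinuousLinearMap.inCoordinates]
    rfl⟩
  map_add' f g := ContMDiffSection.ext fun x =>
    mfderiv_add ((f.contMDiff x).mdifferentiableAt (by simp))
      ((g.contMDiff x).mdifferentiableAt (by simp))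
  map_smul' c f := ContMDiffSection.ext fun x =>
    const_smul_mfderiv ((f.contMDiff x).mdifferentiableAt (by simp)) c
  map_one_eq_zero' := ContMDiffSection.ext fun x => mfderiv_const
  leibniz' f g := ContMDiffSection.ext fun x => by
    have h := (((f.contMDiff x).mdifferentiableAt (by simp)).hasMFDerivAt.mul
      ((g.contMDiff x).mdifferentiableAt (by simp)).hasMFDerivAt).mfderiv
    exact h

theorem HolFun.d_apply (f : HolFun X) (x : X) : HolFun.d f x = mfderiv 𝓘(ℂ) 𝓘(ℂ) f x := rfl

/-- The integral `∫_γ η` of a holomorphic 1-form along a path `γ : [0, 1] → X` of class `C¹`. -/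
def HolForm.pathIntegral (η : HolForm X) (γ : ℝ → X) : ℂ :=
  ∫ t in (0 : ℝ)..1,
    (η (γ t) (mfderivWithin 𝓘(ℝ, ℝ) 𝓘(ℝ, ℂ) γ (Set.Icc 0 1) t (1 : ℝ) : ℂ) : ℂ)

/-- `F` is the function `z ↦ ∫_{x₀}^z η`: for every `z` and every path `γ` of class `C¹` from `x₀`
to `z`, the value `F z` is the integral of `η` along `γ`. -/
def HolForm.IsIntegralFrom (η : HolForm X) (x₀ : X) (F : HolFun X) : Prop :=
  ∀ (z : X) (γ : ℝ → X), ContMDiffOn 𝓘(ℝ, ℝ) 𝓘(ℝ, ℂ) 1 γ (Set.Icc 0 1) → γ 0 = x₀ → γ 1 = z →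
    F z = η.pathIntegral γ

variable (X)

/-- A (unital, graded) sub-dga of the dga `Ω_hol^•(X) = (𝒪_hol(X) ⊕ Ω_hol(X), d)` of holomorphic
forms on `X`, which is concentrated in degrees `0` and `1` as `X` has dimension one. -/
@[ext] structure SubDGA where
  /-- the part of degree zero -/
  deg0 : Subalgebra ℂ (HolFun X)
  /-- the part of degree one -/
  deg1 : Submodule ℂ (HolForm X)
  smul_mem : ∀ f ∈ deg0, ∀ η ∈ deg1, f • η ∈ deg1
  d_mem : ∀ f ∈ deg0, HolFun.d f ∈ deg1

variable {X}

namespace SubDGA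

/-- The order is the inclusion of sub-dgas. -/
instance : PartialOrder (SubDGA X) :=
  PartialOrder.lift (fun E => (E.deg0, E.deg1)) fun _ _ h =>
    SubDGA.ext (congrArg Prod.fst h) (congrArg Prod.snd h)

/-- The intersection of a set of sub-dgas. -/
instance : InfSet (SubDGA X) where
  sInf S :=
    { deg0 := ⨅ E ∈ S, E.deg0
      deg1 := ⨅ E ∈ S, E.deg1
      smul_mem := fun f hf η hη => by
        simp only [Algebra.mem_iInf, Submodule.mem_iInf] at hf hη ⊢
        exact fun E hE => E.smul_mem f (hf E hE) η (hη E hE)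
      d_mem := fun f hf => by
        simp only [Algebra.mem_iInf, Submodule.mem_iInf] at hf ⊢
        exact fun E hE => E.d_mem f (hf E hE) }

/-- The differential of a sub-dga, from degree zero to degree one. -/
def d (E : SubDGA X) : E.deg0 →ₗ[ℂ] E.deg1 :=
  (HolFun.d (X := X)).toLinearMap.restrict (p := Subalgebra.toSubmodule E.deg0) E.d_mem

/-- The cohomology in degree one. All elements of degree one are closed, as there is nothing in
degree two. -/
abbrev H1 (E : SubDGA X) : Type _ := E.deg1 ⧸ LinearMap.range E.d

end SubDGA

end Forms

/-! ## Stable subalgebras and acyclic extensions -/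

namespace UniversalCover

variable {R : Type*} [CommRing R] [Algebra ℂ R] {X : Type*} [TopologicalSpace X] [ChartedSpace ℂ X]
  [IsManifold 𝓘(ℂ) ω X] [SimplyConnectedSpace X] (p : UniversalCover R X)

/-- The pull-back `p^* : 𝒪(C) → 𝒪_hol(X)` of regular functions. -/
def pullbackFun : R →ₐ[ℂ] HolFun X where
  toFun r := ⟨fun x => (p.proj x).eval r, fun x =>
    (p.holomorphicAt_iff x fun y => y.eval r).1 (ComplexPoints.holomorphicAt_eval r _)⟩
  map_one' := ContMDiffMap.ext fun x => map_one (show R →ₐ[ℂ] ℂ from p.proj x)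
  map_mul' r s := ContMDiffMap.ext fun x => map_mul (show R →ₐ[ℂ] ℂ from p.proj x) r s
  map_zero' := ContMDiffMap.ext fun x => map_zero (show R →ₐ[ℂ] ℂ from p.proj x)
  map_add' r s := ContMDiffMap.ext fun x => map_add (show R →ₐ[ℂ] ℂ from p.proj x) r s
  commutes' c := ContMDiffMap.ext fun x => AlgHom.commutes (show R →ₐ[ℂ] ℂ from p.proj x) c

/-- The pull-back `p^* : Ω(C) → Ω_hol(X)` of regular differentials, where `Ω(C)` is the module of
Kähler differentials of `R` over `ℂ`. It is the linear map with
`p^*(r ds) = p^*(r) d(p^*(s))`. -/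
def pullbackForm : Ω[R⁄ℂ] →ₗ[ℂ] HolForm X :=
  letI : Module R (HolForm X) := Module.compHom (HolForm X) (p.pullbackFun : R →+* HolFun X)
  haveI : IsScalarTower ℂ R (HolForm X) := ⟨fun c r η => by
    change p.pullbackFun (c • r) • η = c • p.pullbackFun r • η
    rw [map_smul, smul_assoc]⟩
  let D : Derivation ℂ R (HolForm X) :=
    { toLinearMap := (HolFun.d (X := X)).toLinearMap ∘ₗ p.pullbackFun.toLinearMap
      map_one_eq_zero' := by simp
      leibniz' := fun r s => by
        change HolFun.d (p.pullbackFun (r * s)) =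
          p.pullbackFun r • HolFun.d (p.pullbackFun s) + p.pullbackFun s • HolFun.d (p.pullbackFun r)
        rw [map_mul, Derivation.leibniz] }
  D.liftKaehlerDifferential.restrictScalars ℂ

theorem pullbackForm_smul_D (r s : R) :
    p.pullbackForm (r • KaehlerDifferential.D ℂ R s) =
      p.pullbackFun r • HolFun.d (p.pullbackFun s) := by
  let _ : Module R (HolForm X) := Module.compHom (HolForm X) (p.pullbackFun : R →+* HolFun X)
  have : IsScalarTower ℂ R (HolForm X) := ⟨fun c r η => by
    change p.pullbackFun (c • r) • η = c • p.pullbackFun r • η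
    rw [map_smul, smul_assoc]⟩
  simp only [pullbackForm, LinearMap.restrictScalars_apply, map_smul,
    Derivation.liftKaehlerDifferential_comp_D]
  rfl

/-- A stable subalgebra of `𝒪_hol(X)`: a unital subalgebra `A` such that for all `f ∈ A`, all
regular differentials `α` on `C` and all `x₀ ∈ X`, the function `z ↦ ∫_{x₀}^z f · p^*α` belongs
to `A`. -/
def IsStable (A : Subalgebra ℂ (HolFun X)) : Prop :=
  ∀ f ∈ A, ∀ (α : Ω[R⁄ℂ]) (x₀ : X), ∃ F ∈ A, (f • p.pullbackForm α).IsIntegralFrom x₀ F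

/-- The intersection `A_C` of all stable subalgebras of `𝒪_hol(X)`. -/
def minimalStableSubalgebra : Subalgebra ℂ (HolFun X) := sInf {A | p.IsStable A}

/-- An acyclic extension of the dga `Ω^•(C) = (𝒪(C) ⊕ Ω(C), d)`: a sub-dga `E` of `Ω_hol^•(X)`
containing the image of `Ω^•(C)` under `p^*`, and such that `H¹(E) = 0`. -/
structure IsAcyclicExtension (E : SubDGA X) : Prop where
  pullbackFun_mem : ∀ r : R, p.pullbackFun r ∈ E.deg0
  pullbackForm_mem : ∀ α : Ω[R⁄ℂ], p.pullbackForm α ∈ E.deg1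
  acyclic : Subsingleton E.H1

/-- The intersection `E_C` of all acyclic extensions of `Ω^•(C)`. -/
def minimalAcyclicExtension : SubDGA X := sInf {E | p.IsAcyclicExtension E}

end UniversalCover

end

/-! On a simply connected Riemann surface every holomorphic 1-form has a primitive
(`HolForm.exists_primitive`), unique up to a constant. Since subalgebras contain the constants, A is
stable iff it contains every primitive of every f · p^*α with f ∈ A (`isStable_iff`). This condition
passes to intersections, so A_C is stable.

If E is an acyclic extension, f · p^*α with f ∈ E⁰ lies in E¹, so its primitives lie in E⁰. Thus E⁰
is stable, A_C ⊆ E⁰ and d(A_C) ⊆ E¹.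

It remains to see that A_C ⊕ d(A_C) is a dga, i.e. that d(A_C) is an A_C-module. In fact d(A_C) =
A_C · p^*Ω(C): stability gives ⊇, and ⊆ holds because the g ∈ A_C with dg ∈ A_C · p^*Ω(C) form a
stable subalgebra, which is all of A_C by minimality. -/

noncomputable section

/-! ### Integration of exact forms along real C¹ paths -/

section Real
variable {X : Type*} [TopologicalSpace X] [ChartedSpace ℂ X]

theorem IsManifold.restrictScalars_complex_real [IsManifold 𝓘(ℂ) ω X] :
    IsManifold 𝓘(ℝ, ℂ) ω X :=
  isManifold_of_contDiffOn _ _ _ fun _ _ he he' =>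
    ((contDiffGroupoid ω 𝓘(ℂ)).compatible he he').1.restrict_scalars ℝ

theorem ContMDiffAt.restrictScalars_complex_real {f : X → ℂ} {x : X} {n : ℕ∞ω}
    (h : ContMDiffAt 𝓘(ℂ) 𝓘(ℂ) n f x) : ContMDiffAt 𝓘(ℝ, ℂ) 𝓘(ℝ, ℂ) n f x := by
  rw [contMDiffAt_iff] at h ⊢
  exact ⟨h.1, h.2.restrict_scalars ℝ⟩

theorem HasMFDerivAt.restrictScalars_complex_real {f : X → ℂ} {x : X} {f' : ℂ →L[ℂ] ℂ}
    (h : HasMFDerivAt 𝓘(ℂ) 𝓘(ℂ) f x f') :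
    HasMFDerivAt 𝓘(ℝ, ℂ) 𝓘(ℝ, ℂ) f x (f'.restrictScalars ℝ) :=
  ⟨h.1, HasFDerivWithinAt.restrictScalars ℝ h.2⟩

/-- The fundamental theorem of calculus for F ∘ γ, with F regarded as a map between real manifolds.
-/
theorem HolForm.pathIntegral_d [IsManifold 𝓘(ℂ) ω X] (F : HolFun X) {γ : ℝ → X}
    (hγ : ContMDiffOn 𝓘(ℝ, ℝ) 𝓘(ℝ, ℂ) 1 γ (Set.Icc 0 1)) :
    (HolFun.d F).pathIntegral γ = F (γ 1) - F (γ 0) := by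
  have hF : ContMDiff 𝓘(ℝ, ℂ) 𝓘(ℝ, ℂ) 1 F := fun x =>
    ((F.contMDiff x).restrictScalars_complex_real).of_le (by simp)
  have hc : ContDiffOn ℝ 1 (F ∘ γ) (Set.Icc 0 1) :=
    contMDiffOn_iff_contDiffOn.1 (hF.comp_contMDiffOn hγ)
  rw [show F (γ 1) - F (γ 0) = (F ∘ γ) 1 - (F ∘ γ) 0 from rfl,
    ← intervalIntegral.integral_derivWithin_Icc_of_contDiffOn_Icc hc zero_le_one]
  refine intervalIntegral.integral_congr fun t ht => ?_
  rw [Set.uIcc_of_le zero_le_one] at ht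
  have hF' := ((F.contMDiff (γ t)).mdifferentiableAt (by simp)).hasMFDerivAt
  have hγ' := ((hγ t ht).mdifferentiableWithinAt (by simp)).hasMFDerivWithinAt
  have h := (hF'.restrictScalars_complex_real.comp_hasMFDerivWithinAt t hγ')
  have h' : HasFDerivWithinAt (F ∘ γ) (_ : ℝ →L[ℝ] ℂ) (Set.Icc 0 1) t :=
    hasMFDerivWithinAt_iff_hasFDerivWithinAt.1 h
  exact (h'.hasDerivWithinAt.derivWithin (uniqueDiffOn_Icc zero_lt_one t ht)).symm

end Real

/-! ### Connectedness by C¹ paths -/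

section Paths

variable {X : Type*} [TopologicalSpace X] [ChartedSpace ℂ X]

/-- There is a path of class `C¹` from `x` to `y` which is constant outside `[0, 1]`. -/
def JoinedC1 (x y : X) : Prop :=
  ∃ γ : ℝ → X, ContMDiff 𝓘(ℝ, ℝ) 𝓘(ℝ, ℂ) 1 γ ∧ (∀ t ≤ 0, γ t = x) ∧ ∀ t, 1 ≤ t → γ t = y

theorem JoinedC1.symm {x y : X} (h : JoinedC1 x y) : JoinedC1 y x := by
  obtain ⟨γ, hγ, h0, h1⟩ := h
  refine ⟨fun t => γ (1 - t), hγ.comp ?_, fun t ht => h1 _ (by linarith),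
    fun t ht => h0 _ (by linarith)⟩
  exact ContDiff.contMDiff (by fun_prop)

theorem JoinedC1.trans {x y z : X} (h : JoinedC1 x y) (h' : JoinedC1 y z) : JoinedC1 x z := by
  obtain ⟨γ, hγ, h0, h1⟩ := h
  obtain ⟨δ, hδ, k0, k1⟩ := h'
  have hγ' : ContMDiff 𝓘(ℝ, ℝ) 𝓘(ℝ, ℂ) 1 fun t : ℝ => γ (3 * t) :=
    hγ.comp (ContDiff.contMDiff (by fun_prop))
  have hδ' : ContMDiff 𝓘(ℝ, ℝ) 𝓘(ℝ, ℂ) 1 fun t : ℝ => δ (3 * t - 2) :=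
    hδ.comp (ContDiff.contMDiff (by fun_prop))
  -- Both reparametrised paths rest at `y` for 1/3 ≤ t ≤ 2/3, so switching at 1/2 is C¹. The bound
  -- 7/12 is any number strictly between 1/2 and 2/3.
  refine ⟨fun t => if t ≤ 1 / 2 then γ (3 * t) else δ (3 * t - 2), fun t => ?_, fun t ht => ?_,
    fun t ht => ?_⟩
  · rcases lt_or_ge t (7 / 12) with ht | ht
    · refine (hγ' t).congr_of_eventuallyEq ?_
      filter_upwards [gt_mem_nhds ht] with s hs
      split_ifs with hs'
      · rfl
      · rw [h1 _ (by linarith), k0 _ (by linarith)]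
    · refine (hδ' t).congr_of_eventuallyEq ?_
      filter_upwards [lt_mem_nhds (show (1 / 2 : ℝ) < t by linarith)] with s hs
      rw [if_neg (by linarith)]
  · dsimp only
    rw [if_pos (by linarith)]
    exact h0 _ (by linarith)
  · dsimp only
    rw [if_neg (by linarith)]
    exact k1 _ (by linarith)

theorem JoinedC1.eventually [IsManifold 𝓘(ℂ) ω X] (x : X) : ∀ᶠ y in 𝓝 x, JoinedC1 x y := by
  have : IsManifold 𝓘(ℝ, ℂ) ω X := IsManifold.restrictScalars_complex_real
  have : IsManifold 𝓘(ℝ, ℂ) 1 X := IsManifold.of_le (n := ω) (by simp)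
  set φ := chartAt ℂ x
  have hx : x ∈ φ.source := mem_chart_source ℂ x
  obtain ⟨r, hr, hb⟩ := Metric.isOpen_iff.1 φ.open_target _ (φ.map_source hx)
  filter_upwards [φ.open_source.mem_nhds hx,
    φ.continuousAt hx (Metric.ball_mem_nhds _ hr)] with y hy hyr
  -- A straight segment in a chart disc, run at a speed that makes it constant outside [0, 1].
  set σ : ℝ → ℝ := fun t => Real.smoothTransition t
  have hσ : ContDiff ℝ 1 σ := Real.smoothTransition.contDiff
  set c : ℝ → ℂ := fun t => φ x + σ t • (φ y - φ x)
  have hc : ContDiff ℝ 1 c := by fun_prop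
  have hcm : ∀ t, c t ∈ φ.target := fun t => hb <|
    (convex_ball (φ x) r).add_smul_sub_mem (Metric.mem_ball_self hr) hyr
      ⟨Real.smoothTransition.nonneg _, Real.smoothTransition.le_one _⟩
  refine ⟨fun t => φ.symm (c t), ?_, fun t ht => ?_, fun t ht => ?_⟩
  · exact (contMDiffOn_chart_symm (I := 𝓘(ℝ, ℂ)) (x := x)).comp_contMDiff hc.contMDiff hcm
  · have : σ t = 0 := Real.smoothTransition.zero_of_nonpos (by linarith)
    simp [c, this, φ.left_inv hx]
  · have : σ t = 1 := Real.smoothTransition.one_of_one_le (by linarith)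
    simp [c, this, φ.left_inv hy]

theorem joinedC1 [IsManifold 𝓘(ℂ) ω X] [PreconnectedSpace X] (x y : X) : JoinedC1 x y :=
  PreconnectedSpace.induction₂' JoinedC1
    (fun x => (JoinedC1.eventually x).mono fun _ h => ⟨h, h.symm⟩)
    ⟨fun _ _ _ => JoinedC1.trans⟩ x y

/-- A holomorphic function is determined by its being an integral of `dF`. -/
theorem HolForm.isIntegralFrom_d_iff [IsManifold 𝓘(ℂ) ω X] [PreconnectedSpace X]
    (F G : HolFun X) (x₀ : X) :
    (HolFun.d F).IsIntegralFrom x₀ G ↔ G = F - algebraMap ℂ (HolFun X) (F x₀) := by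
  constructor
  · intro h
    ext z
    -- Without a C¹ path to `z`, the integral condition would say nothing about `G z`.
    obtain ⟨γ, hγ, h0, h1⟩ := joinedC1 x₀ z
    have := h z γ hγ.contMDiffOn (h0 0 (by norm_num)) (h1 1 (by norm_num))
    rw [this, pathIntegral_d F hγ.contMDiffOn, h0 0 (by norm_num), h1 1 (by norm_num)]
    rfl
  · rintro rfl z γ hγ rfl rfl
    rw [pathIntegral_d F hγ]
    rfl

end Paths

/-! ### Gluing along locally constant differences -/

section Glue

/-- On a simply connected space, functions which are given locally and agree up to locally constant
functions come from a global function. -/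
theorem exists_eventually_sub_eq_of_simplyConnected {X A : Type*} [TopologicalSpace X]
    [SimplyConnectedSpace X] [LocallyPathConnectedSpace X] [AddCommGroup A] (U : X → Set X)
    (hU : ∀ i, IsOpen (U i)) (hmem : ∀ i, i ∈ U i) (G : X → X → A)
    (hG : ∀ i j, ∀ x ∈ U i ∩ U j, ∀ᶠ y in 𝓝 x, G i y - G j y = G i x - G j x) :
    ∃ F : X → A, ∀ i, ∀ x ∈ U i, ∀ᶠ y in 𝓝 x, F y - G i y = F x - G i x := by
  let _ : TopologicalSpace A := ⊥
  have : DiscreteTopology A := ⟨rfl⟩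
  -- The coordinate of a section in the i-th trivialization stands for F - G i. As G i - G j is
  -- locally constant and the fibre discrete, this is a covering; lifting the identity of X gives a
  -- global section.
  let Z : FiberBundleCore X X A :=
    { baseSet := U
      isOpen_baseSet := hU
      indexAt := id
      mem_baseSet_at := hmem
      coordChange := fun i j x v => v + (G i x - G j x)
      coordChange_self := fun i x _ v => by simp
      continuousOn_coordChange := fun i j => by
        rintro ⟨x, v⟩ ⟨hx, -⟩
        refine ContinuousAt.continuousWithinAt ?_
        refine continuousAt_snd.add (ContinuousAt.comp (g := fun y => G i y - G j y)
          ?_ continuousAt_fst)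
        exact continuousAt_const.congr ((hG i j x hx).mono fun _ h => h.symm)
      coordChange_comp := fun i j k x _ v => by abel }
  have hcov : IsCoveringMap (Bundle.TotalSpace.proj : Z.TotalSpace → X) :=
    FiberBundle.isCoveringMap (F := A) (E := Z.Fiber)
  obtain ⟨x₀⟩ : Nonempty X := inferInstance
  obtain ⟨s, ⟨-, hs⟩, -⟩ := hcov.existsUnique_continuousMap_lifts (ContinuousMap.id X) x₀
    (⟨x₀, (0 : A)⟩ : Z.TotalSpace) rfl
  have hs' : ∀ x, (s x).1 = x := fun x => congrFun hs x
  let c : X → A := fun x => (s x).2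
  refine ⟨fun x => c x + G x x, fun i x hx => ?_⟩
  have key : ∀ y, (Z.localTriv i (s y)).2 = c y + G y y - G i y := fun y => by
    rw [Z.localTriv_apply]
    change c y + (G (s y).1 (s y).1 - G i (s y).1) = _
    rw [hs', add_sub_assoc]
  have hcont : ContinuousAt (fun y => (Z.localTriv i (s y)).2) x := by
    refine continuousAt_snd.comp (ContinuousAt.comp ?_ s.continuous.continuousAt)
    refine (Z.localTriv i).continuousAt ?_
    rw [(Z.localTriv i).mem_source]
    change (s x).1 ∈ U i
    rwa [hs']
  simp only [key] at hcont
  have : c x + G x x - G i x ∈ ({c x + G x x - G i x} : Set A) := rfl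
  exact hcont.eventually (mem_nhds_discrete.2 this)

end Glue

/-! ### Existence of primitives -/

section Primitive

variable {X : Type*} [TopologicalSpace X] [ChartedSpace ℂ X] [IsManifold 𝓘(ℂ) ω X]

theorem eventually_eq_of_hasMFDerivAt_zero {f : X → ℂ} {x : X}
    (h : ∀ᶠ y in 𝓝 x, HasMFDerivAt 𝓘(ℂ) 𝓘(ℂ) f y (0 : ℂ →L[ℂ] ℂ)) :
    ∀ᶠ y in 𝓝 x, f y = f x := by
  set φ := chartAt ℂ x
  have hx : x ∈ φ.source := mem_chart_source ℂ x
  have hsymm : ContinuousAt φ.symm (φ x) := φ.continuousAt_symm (φ.map_source hx)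
  have h' : ∀ᶠ z in 𝓝 (φ x), z ∈ φ.target ∧
      HasMFDerivAt 𝓘(ℂ) 𝓘(ℂ) f (φ.symm z) (0 : ℂ →L[ℂ] ℂ) :=
    Filter.Eventually.and (φ.open_target.mem_nhds (φ.map_source hx))
      (hsymm.eventually (by rwa [φ.left_inv hx]))
  obtain ⟨r, hr, hb⟩ := Metric.eventually_nhds_iff_ball.1 h'
  have hd : ∀ z ∈ Metric.ball (φ x) r, HasFDerivAt (f ∘ φ.symm) (0 : ℂ →L[ℂ] ℂ) z := fun z hz => by
    have h1 := ((contMDiffOn_chart_symm (I := 𝓘(ℂ)) (n := ω) (x := x)).contMDiffAt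
      (φ.open_target.mem_nhds (hb z hz).1)).mdifferentiableAt (by simp)
    have h2 := (hb z hz).2.comp z h1.hasMFDerivAt
    have h3 : HasFDerivAt (f ∘ φ.symm) _ z := hasMFDerivAt_iff_hasFDerivAt.1 h2
    exact h3.congr_fderiv (ContinuousLinearMap.zero_comp _)
  filter_upwards [φ.open_source.mem_nhds hx,
    φ.continuousAt hx (Metric.ball_mem_nhds _ hr)] with y hy hyr
  have := (convex_ball (φ x) r).is_const_of_fderivWithin_eq_zero (𝕜 := ℂ) (f := f ∘ φ.symm)
    (fun z hz => (hd z hz).differentiableAt.differentiableWithinAt)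
    (fun z hz => (hd z hz).hasFDerivWithinAt.fderivWithin
      (Metric.isOpen_ball.uniqueDiffWithinAt hz)) hyr (Metric.mem_ball_self hr)
  simpa [φ.left_inv hx, φ.left_inv hy] using this

/-- In a chart, η = h dz with h analytic, and h has a primitive on a disc. -/
theorem HolForm.exists_local_primitive (η : HolForm X) (x₀ : X) :
    ∃ G : X → ℂ, ∃ U : Set X, IsOpen U ∧ x₀ ∈ U ∧
      ∀ x ∈ U, ContMDiffAt 𝓘(ℂ) 𝓘(ℂ) ω G x ∧ HasMFDerivAt 𝓘(ℂ) 𝓘(ℂ) G x (η x) := by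
  set φ := chartAt ℂ x₀
  have hx : x₀ ∈ φ.source := mem_chart_source ℂ x₀
  have hη := ((contMDiffAt_hom_bundle _).1 (η.contMDiff x₀)).2
  set H : X → ℂ →L[ℂ] ℂ := fun x => ContinuousLinearMap.inCoordinates ℂ (TangentSpace 𝓘(ℂ) (M := X))
    ℂ (Bundle.Trivial X ℂ) x₀ x x₀ x (η x)
  have hH : ContMDiffAt 𝓘(ℂ) 𝓘(ℂ, ℂ →L[ℂ] ℂ) ω H x₀ := hη
  clear hη
  let D : X → ℂ →L[ℂ] ℂ := fun x => mfderiv 𝓘(ℂ) 𝓘(ℂ) φ x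
  -- The formula η = h dφ, with h = `H · 1`.
  have hHη : ∀ x ∈ φ.source, ∀ v : ℂ, (η x) v = D x v * H x 1 := fun x hxs v => by
    have hT := TangentBundle.continuousLinearMapAt_trivializationAt (I := 𝓘(ℂ)) hxs
    have hv := (trivializationAt ℂ (TangentSpace 𝓘(ℂ) (M := X)) x₀).symmL_continuousLinearMapAt
      (R := ℂ) (b := x) (by simpa using hxs) v
    have hv' : H x (D x v) = (η x) v := by
      rw [hT] at hv
      have h1 : ∀ w : ℂ, H x w =
          η x ((trivializationAt ℂ (TangentSpace 𝓘(ℂ) (M := X)) x₀).symmL ℂ x w) := fun w => by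
        simp only [H, ContinuousLinearMap.inCoordinates]
        simp only [Bundle.Trivial.fiberBundle_trivializationAt',
          Bundle.Trivial.continuousLinearMapAt_trivialization]
        rfl
      exact (h1 _).trans (congrArg (η x) hv)
    rw [← hv', ← smul_eq_mul, ← map_smul, smul_eq_mul, mul_one]
  have han : AnalyticAt ℂ (fun z => H (φ.symm z) 1) (φ x₀) := by
    have hs : ContMDiffAt 𝓘(ℂ) 𝓘(ℂ) ω φ.symm (φ x₀) :=
      (contMDiffOn_chart_symm (I := 𝓘(ℂ)) (n := ω) (x := x₀)).contMDiffAt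
        (φ.open_target.mem_nhds (φ.map_source hx))
    have hc : ContMDiffAt 𝓘(ℂ) 𝓘(ℂ, ℂ →L[ℂ] ℂ) ω (H ∘ φ.symm) (φ x₀) :=
      ContMDiffAt.comp _ (by rwa [φ.left_inv hx]) hs
    exact (hc.contDiffAt.clm_apply contDiffAt_const).analyticAt
  obtain ⟨r, hr, hb⟩ := Metric.eventually_nhds_iff_ball.1 <|
    han.eventually_analyticAt.and <| (φ.open_target.mem_nhds (φ.map_source hx))
  obtain ⟨g, hg⟩ := DifferentiableOn.isExactOn_ball
    (fun z hz => (hb z hz).1.differentiableAt.differentiableWithinAt)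
  refine ⟨g ∘ φ, φ.source ∩ φ ⁻¹' Metric.ball (φ x₀) r,
    φ.isOpen_inter_preimage Metric.isOpen_ball, ⟨hx, Metric.mem_ball_self hr⟩, ?_⟩
  rintro x ⟨hxs, hxr⟩
  have hφ : ContMDiffAt 𝓘(ℂ) 𝓘(ℂ) ω φ x :=
    (contMDiffOn_chart (I := 𝓘(ℂ)) (n := ω) (x := x₀)).contMDiffAt (φ.open_source.mem_nhds hxs)
  have hga : AnalyticAt ℂ g (φ x) :=
    DifferentiableOn.analyticAt (fun z hz => (hg z hz).differentiableAt.differentiableWithinAt)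
      (Metric.isOpen_ball.mem_nhds hxr)
  refine ⟨hga.contDiffAt.contMDiffAt.comp x hφ, ?_⟩
  have h := (hg (φ x) hxr).hasFDerivAt.hasMFDerivAt.comp x
    (hφ.mdifferentiableAt (by simp)).hasMFDerivAt
  convert h using 1
  have : (η x : ℂ →L[ℂ] ℂ) = (ContinuousLinearMap.toSpanSingleton ℂ (H (φ.symm (φ x)) 1)).comp
      (mfderiv 𝓘(ℂ) 𝓘(ℂ) φ x : ℂ →L[ℂ] ℂ) := by
    ext
    rw [φ.left_inv hxs]
    exact hHη x hxs 1
  exact iff_of_eq (congrArg _ this)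

theorem HolForm.exists_primitive [SimplyConnectedSpace X] (η : HolForm X) :
    ∃ F : HolFun X, HolFun.d F = η := by
  have : LocallyPathConnectedSpace X := ChartedSpace.locallyPathConnectedSpace ℂ X
  choose G U hU hmem hG using η.exists_local_primitive
  obtain ⟨F, hF⟩ := exists_eventually_sub_eq_of_simplyConnected U hU hmem G fun i j x hx => by
    refine eventually_eq_of_hasMFDerivAt_zero (f := fun y => G i y - G j y) ?_
    filter_upwards [((hU i).inter (hU j)).mem_nhds hx] with y hy
    have := (hG i y hy.1).2.sub (hG j y hy.2).2
    rwa [sub_self] at this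
  have hF' : ∀ x, F =ᶠ[𝓝 x] fun y => G x y + (F x - G x x) := fun x =>
    (hF x x (hmem x)).mono fun y hy => by rw [← hy]; ring
  refine ⟨⟨F, fun x => ?_⟩, ?_⟩
  · exact (((hG x x (hmem x)).1).add contMDiffAt_const).congr_of_eventuallyEq (hF' x)
  · refine ContMDiffSection.ext fun x => ?_
    have h := ((hG x x (hmem x)).2.add (hasMFDerivAt_const (F x - G x x) x)).congr_of_eventuallyEq
      (hF' x)
    exact h.mfderiv.trans (add_zero (η x))

end Primitive

/-! ### Stable subalgebras and acyclic extensions -/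

theorem SubDGA.subsingleton_H1_iff {X : Type*} [TopologicalSpace X] [ChartedSpace ℂ X]
    [IsManifold 𝓘(ℂ) ω X] {E : SubDGA X} :
    Subsingleton E.H1 ↔ ∀ η ∈ E.deg1, ∃ f ∈ E.deg0, HolFun.d f = η := by
  rw [Submodule.Quotient.subsingleton_iff, LinearMap.range_eq_top]
  constructor
  · intro h η hη
    obtain ⟨f, hf⟩ := h ⟨η, hη⟩
    exact ⟨f.1, f.2, congrArg Subtype.val hf⟩
  · rintro h ⟨η, hη⟩
    obtain ⟨f, hf, rfl⟩ := h η hη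
    exact ⟨⟨f, hf⟩, rfl⟩

namespace UniversalCover

variable {R : Type*} [CommRing R] [Algebra ℂ R] {X : Type*} [TopologicalSpace X] [ChartedSpace ℂ X]
  [IsManifold 𝓘(ℂ) ω X] [SimplyConnectedSpace X] {p : UniversalCover R X}

/-- A subalgebra is stable if and only if it contains all primitives of the products of its elements
with regular differentials. -/
theorem isStable_iff {A : Subalgebra ℂ (HolFun X)} :
    p.IsStable A ↔
      ∀ f ∈ A, ∀ (α : Ω[R⁄ℂ]) (F : HolFun X), HolFun.d F = f • p.pullbackForm α → F ∈ A := by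
  constructor
  · intro hA f hf α F hF
    obtain ⟨x₀⟩ : Nonempty X := inferInstance
    obtain ⟨G, hG, hint⟩ := hA f hf α x₀
    rw [← hF, HolForm.isIntegralFrom_d_iff] at hint
    rw [← sub_add_cancel F (algebraMap ℂ (HolFun X) (F x₀)), ← hint]
    exact A.add_mem hG (A.algebraMap_mem _)
  · intro hA f hf α x₀
    obtain ⟨F, hF⟩ := (f • p.pullbackForm α).exists_primitive
    exact ⟨F - algebraMap ℂ (HolFun X) (F x₀), A.sub_mem (hA f hf α F hF) (A.algebraMap_mem _),
      hF ▸ (HolForm.isIntegralFrom_d_iff F _ x₀).2 rfl⟩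

theorem isStable_minimalStableSubalgebra : p.IsStable p.minimalStableSubalgebra := by
  rw [isStable_iff]
  intro f hf α F hF
  simp only [minimalStableSubalgebra, Algebra.mem_sInf] at hf ⊢
  exact fun A hA => isStable_iff.1 hA f (hf A hA) α F hF

theorem minimalStableSubalgebra_le {A : Subalgebra ℂ (HolFun X)} (hA : p.IsStable A) :
    p.minimalStableSubalgebra ≤ A :=
  sInf_le hA

/-- p^*r is a primitive of 1 · p^*(dr). -/
theorem IsStable.pullbackFun_mem {A : Subalgebra ℂ (HolFun X)} (hA : p.IsStable A) (r : R) :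
    p.pullbackFun r ∈ A := by
  refine isStable_iff.1 hA 1 A.one_mem (KaehlerDifferential.D ℂ R r) _ ?_
  have h := p.pullbackForm_smul_D 1 r
  rw [one_smul, map_one] at h
  rw [h, one_smul, one_smul]

theorem IsStable.smul_pullbackForm_mem {A : Subalgebra ℂ (HolFun X)} (hA : p.IsStable A)
    {f : HolFun X} (hf : f ∈ A) (α : Ω[R⁄ℂ]) :
    f • p.pullbackForm α ∈ A.toSubmodule.map (HolFun.d (X := X)).toLinearMap := by
  obtain ⟨F, hF⟩ := (f • p.pullbackForm α).exists_primitive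
  exact ⟨F, isStable_iff.1 hA f hf α F hF, hF⟩

variable (p) in
/-- The space of forms `A · p^*Ω(C)`. -/
def smulForms (A : Subalgebra ℂ (HolFun X)) : Submodule ℂ (HolForm X) :=
  Submodule.span ℂ {η | ∃ f ∈ A, ∃ α : Ω[R⁄ℂ], f • p.pullbackForm α = η}

theorem smul_mem_smulForms {A : Subalgebra ℂ (HolFun X)} {f : HolFun X} (hf : f ∈ A)
    {η : HolForm X} (hη : η ∈ p.smulForms A) : f • η ∈ p.smulForms A := by
  induction hη using Submodule.span_induction with
  | mem η h =>
    obtain ⟨g, hg, α, rfl⟩ := h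
    exact Submodule.subset_span ⟨f * g, A.mul_mem hf hg, α, mul_smul _ _ _⟩
  | zero => rw [smul_zero]; exact zero_mem _
  | add η θ _ _ h h' => exact (smul_add f η θ : f • (η + θ) = _) ▸ add_mem h h'
  | smul c η _ h => rw [smul_algebra_smul_comm]; exact Submodule.smul_mem _ c h

theorem IsStable.smulForms_le {A : Subalgebra ℂ (HolFun X)} (hA : p.IsStable A) :
    p.smulForms A ≤ A.toSubmodule.map (HolFun.d (X := X)).toLinearMap := by
  refine Submodule.span_le.2 ?_
  rintro _ ⟨f, hf, α, rfl⟩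
  exact hA.smul_pullbackForm_mem hf α

/-- The elements of a subalgebra `A` whose differential lies in `A · p^*Ω(C)`. -/
def differentialSubalgebra (p : UniversalCover R X) (A : Subalgebra ℂ (HolFun X)) :
    Subalgebra ℂ (HolFun X) where
  carrier := {g | g ∈ A ∧ HolFun.d g ∈ p.smulForms A}
  mul_mem' := fun {f g} hf hg => ⟨A.mul_mem hf.1 hg.1, by
    rw [Derivation.leibniz]
    exact add_mem (smul_mem_smulForms hf.1 hg.2) (smul_mem_smulForms hg.1 hf.2)⟩
  add_mem' := fun {f g} hf hg => ⟨A.add_mem hf.1 hg.1, by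
    rw [map_add]
    exact add_mem hf.2 hg.2⟩
  algebraMap_mem' := fun c => ⟨A.algebraMap_mem c, by
    rw [Derivation.map_algebraMap]
    exact zero_mem _⟩

/-- A primitive of f · p^*α has its differential in A · p^*Ω(C) by construction. -/
theorem IsStable.differentialSubalgebra {A : Subalgebra ℂ (HolFun X)} (hA : p.IsStable A) :
    p.IsStable (p.differentialSubalgebra A) := by
  rw [isStable_iff] at hA ⊢
  intro f hf α F hF
  exact ⟨hA f hf.1 α F hF, hF ▸ Submodule.subset_span ⟨f, hf.1, α, rfl⟩⟩

/-- Minimality forces A_C into its own `differentialSubalgebra`. The right-hand side is visibly an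
A_C-module, which makes `stableSubDGA` closed under products. -/
theorem map_d_minimalStableSubalgebra :
    p.minimalStableSubalgebra.toSubmodule.map (HolFun.d (X := X)).toLinearMap =
      p.smulForms p.minimalStableSubalgebra := by
  refine le_antisymm ?_ isStable_minimalStableSubalgebra.smulForms_le
  rintro _ ⟨g, hg, rfl⟩
  exact (minimalStableSubalgebra_le isStable_minimalStableSubalgebra.differentialSubalgebra hg).2

variable (p) in
/-- The sub-dga `(A_C ⊕ d(A_C), d)`. -/
def stableSubDGA : SubDGA X where
  deg0 := p.minimalStableSubalgebra
  deg1 := p.minimalStableSubalgebra.toSubmodule.map (HolFun.d (X := X)).toLinearMap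
  smul_mem := fun f hf η hη => by
    rw [map_d_minimalStableSubalgebra] at hη ⊢
    exact smul_mem_smulForms hf hη
  d_mem := fun f hf => ⟨f, hf, rfl⟩

theorem isAcyclicExtension_stableSubDGA : p.IsAcyclicExtension p.stableSubDGA where
  pullbackFun_mem := isStable_minimalStableSubalgebra.pullbackFun_mem
  pullbackForm_mem α := by
    have := isStable_minimalStableSubalgebra.smul_pullbackForm_mem
      p.minimalStableSubalgebra.one_mem α
    rwa [one_smul] at this
  acyclic := SubDGA.subsingleton_H1_iff.2 fun _ ⟨f, hf, h⟩ => ⟨f, hf, h⟩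

theorem _root_.HolFun.eq_add_algebraMap_of_d_eq {F G : HolFun X} (h : HolFun.d F = HolFun.d G) :
    ∃ c : ℂ, F = G + algebraMap ℂ (HolFun X) c := by
  obtain ⟨x₀⟩ : Nonempty X := inferInstance
  have hF := (HolForm.isIntegralFrom_d_iff F _ x₀).2 rfl
  rw [h, HolForm.isIntegralFrom_d_iff] at hF
  refine ⟨F x₀ - G x₀, ?_⟩
  rw [map_sub]
  linear_combination hF

/-- Acyclicity provides one primitive in E⁰; any other differs from it by a constant. -/
theorem IsAcyclicExtension.isStable {E : SubDGA X} (hE : p.IsAcyclicExtension E) :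
    p.IsStable E.deg0 := by
  rw [isStable_iff]
  intro f hf α F hF
  obtain ⟨G, hG, hGF⟩ := SubDGA.subsingleton_H1_iff.1 hE.acyclic _
    (E.smul_mem f hf _ (hE.pullbackForm_mem α))
  obtain ⟨c, rfl⟩ := HolFun.eq_add_algebraMap_of_d_eq (hF.trans hGF.symm)
  exact E.deg0.add_mem hG (E.deg0.algebraMap_mem c)

theorem stableSubDGA_le {E : SubDGA X} (hE : p.IsAcyclicExtension E) : p.stableSubDGA ≤ E := by
  have h : p.minimalStableSubalgebra ≤ E.deg0 := minimalStableSubalgebra_le hE.isStable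
  refine ⟨h, ?_⟩
  rintro _ ⟨f, hf, rfl⟩
  exact E.d_mem f (h hf)

theorem minimalAcyclicExtension_eq : p.minimalAcyclicExtension = p.stableSubDGA := by
  refine le_antisymm (show _ ∧ _ from ⟨iInf₂_le _ isAcyclicExtension_stableSubDGA,
    iInf₂_le _ isAcyclicExtension_stableSubDGA⟩) (show _ ∧ _ from
    ⟨le_iInf₂ fun E hE => (stableSubDGA_le hE).1, le_iInf₂ fun E hE => (stableSubDGA_le hE).2⟩)

end UniversalCover

end

theorem mainTheorem7 (R : Type*) [CommRing R] [IsDomain R] [Algebra ℂ R] [Algebra.Smooth ℂ R]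
    (hdim : ringKrullDim R = 1)
    (X : Type*) [TopologicalSpace X] [ChartedSpace ℂ X] [IsManifold 𝓘(ℂ) ω X]
    [SimplyConnectedSpace X] (p : UniversalCover R X) :
    IsLeast {A | p.IsStable A} p.minimalStableSubalgebra ∧
    IsLeast {E | p.IsAcyclicExtension E} p.minimalAcyclicExtension ∧
    p.minimalAcyclicExtension.deg0 = p.minimalStableSubalgebra ∧
    p.minimalAcyclicExtension.deg1 =
      (Subalgebra.toSubmodule p.minimalStableSubalgebra).map
        (HolFun.d (X := X)).toLinearMap := by

  rw [UniversalCover.minimalAcyclicExtension_eq]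
  exact ⟨⟨UniversalCover.isStable_minimalStableSubalgebra,
      fun _ hA => UniversalCover.minimalStableSubalgebra_le hA⟩,
    ⟨UniversalCover.isAcyclicExtension_stableSubDGA,
      fun _ hE => UniversalCover.stableSubDGA_le hE⟩, rfl, rfl⟩
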